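/- Let $G$ be a (simple, undirected, possibly infinite) graph. A \emph{ray} of $G$ is a one-way infinite path in $G$; two rays are equivalent if no finite set of vertices separates them in $G$, and the \emph{ends} of $G$ are the equivalence classes of rays. The \emph{vertex-degree} of an end $\omega$ is the maximum cardinality (a natural number or $\infty$) of a set of pairwise vertex-disjoint rays in $\omega$. For $k\in\mathbb N$, the \emph{$[k]\times\mathbb N$ grid} is the graph on $\{1,\dots,k\}\times\mathbb N$ in which two vertices are adjacent if they agree in one coordinate and differ by exactly $1$ in the other. \textbf{Theorem.} Let $k\in\mathbb N$ and let $G$ be a graph which has an end $\omega$ of vertex-degree at least $\frac32 k-1$. Then the $[k]\times\mathbb N$ grid is a minor of $G$, and the grid's rays can be taken in $\omega$. More precisely, there are pairwise disjoint finite non-empty sets $B_{i,n}\subseteq V(G)$ (for $1\le i\le k$, $n\in\mathbb N$), each inducing a connected subgraph of $G$, such that $G$ has an edge between $B_{i,m}$ and $B_{j,n}$ whenever $(i,m)$ and $(j,n)$ are adjacent in the grid, and such that (a) for each $i$ there is a ray of $G$ belonging to $\omega$ whose vertices all lie in $\bigcup_n B_{i,n}$ and which runs through the sets $B_{i,n}$,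 $n\in\mathbb N$, one after the other in increasing order of $n$, visiting each of them; (b) every ray of $G$ all of whose vertices lie in $\bigcup_{i,n}B_{i,n}$ belongs to $\omega$. -/

import Mathlib

namespace SimpleGraph

universe u v

/-- A ray (one-way infinite path) of `G`, given by its sequence of distinct vertices. -/
structure Ray {V : Type u} (G : SimpleGraph V) where
  vert : ℕ → V
  injective : Function.Injective vert
  adj : ∀ n, G.Adj (vert n) (vert (n + 1))

/-- The vertex set of a ray. -/
def Ray.verts {V : Type u} {G : SimpleGraph V} (R : G.Ray) : Set V :=
  Set.range R.vert

/-- The vertex set `S` separates `A` from `B` in `G`: every walk from `A` to `B` meets `S`. -/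
def Separates {V : Type u} (G : SimpleGraph V) (S A B : Set V) : Prop :=
  ∀ a ∈ A, ∀ b ∈ B, ∀ p : G.Walk a b, ∃ x ∈ p.support, x ∈ S

/-- Two rays are equivalent if no finite set of vertices separates them. -/
def Ray.Equivalent {V : Type u} {G : SimpleGraph V} (R Q : G.Ray) : Prop :=
  ∀ S : Set V, S.Finite → ¬ G.Separates S R.verts Q.verts

theorem Ray.Equivalent.refl {V : Type u} {G : SimpleGraph V} (R : G.Ray) : R.Equivalent R := by
  intro S hS h
  obtain ⟨x, ⟨n, rfl⟩, hx⟩ := (Set.infinite_range_of_injective R.injective).exists_notMem_finite hS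
  obtain ⟨y, hy, hyS⟩ := h (R.vert n) ⟨n, rfl⟩ (R.vert n) ⟨n, rfl⟩ Walk.nil
  simp only [Walk.support_nil, List.mem_singleton] at hy
  exact hx (hy ▸ hyS)

theorem Ray.Equivalent.symm {V : Type u} {G : SimpleGraph V} {R Q : G.Ray}
    (h : R.Equivalent Q) : Q.Equivalent R := by
  intro S hS hsep
  refine h S hS fun a ha b hb p => ?_
  obtain ⟨x, hx, hxS⟩ := hsep b hb a ha p.reverse
  exact ⟨x, by simpa using hx, hxS⟩

theorem Ray.exists_walk {V : Type u} {G : SimpleGraph V} (R : G.Ray) (m d : ℕ) :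
    ∃ p : G.Walk (R.vert m) (R.vert (m + d)), ∀ x ∈ p.support, ∃ n, m ≤ n ∧ x = R.vert n := by
  induction d with
  | zero => exact ⟨Walk.nil, fun x hx => ⟨m, le_rfl, by simpa using hx⟩⟩
  | succ d ih =>
    obtain ⟨p, hp⟩ := ih
    refine ⟨p.concat (R.adj (m + d)), fun x hx => ?_⟩
    rw [Walk.support_concat] at hx
    simp only [List.concat_eq_append, List.mem_append, List.mem_singleton] at hx
    rcases hx with hx | hx
    · exact hp x hx
    · exact ⟨m + d + 1, by omega, hx⟩

theorem Ray.Equivalent.trans {V : Type u} {G : SimpleGraph V} {R Q P : G.Ray}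
    (h : R.Equivalent Q) (h' : Q.Equivalent P) : R.Equivalent P := by
  classical
  intro S hS hsep
  have hfin : {n | Q.vert n ∈ S}.Finite := hS.preimage Q.injective.injOn
  obtain ⟨N, hN⟩ := hfin.bddAbove
  have hlate : ∀ n, N < n → Q.vert n ∉ S := fun n hn hs => absurd (hN hs) (by omega)
  have hT : (S ∪ Q.vert '' Set.Iic N).Finite := hS.union ((Set.finite_Iic N).image _)
  have h1 := h _ hT
  have h2 := h' _ hT
  simp only [Separates, not_forall] at h1 h2
  obtain ⟨a, ha, b, ⟨i, rfl⟩, p, hp⟩ := h1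
  obtain ⟨c, ⟨j, rfl⟩, d, hd, q, hq⟩ := h2
  push Not at hp hq
  have hi : N < i := by
    by_contra hc
    exact hp _ p.end_mem_support (Or.inr ⟨i, by simpa using hc, rfl⟩)
  have hj : N < j := by
    by_contra hc
    exact hq _ q.start_mem_support (Or.inr ⟨j, by simpa using hc, rfl⟩)
  have hmid : ∃ r : G.Walk (Q.vert i) (Q.vert j), ∀ x ∈ r.support, x ∉ S := by
    rcases le_total i j with hij | hij
    · obtain ⟨e, rfl⟩ := Nat.exists_eq_add_of_le hij
      obtain ⟨r, hr⟩ := Q.exists_walk i e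
      refine ⟨r, fun x hx => ?_⟩
      obtain ⟨n, hn, rfl⟩ := hr x hx
      exact hlate n (by omega)
    · obtain ⟨e, rfl⟩ := Nat.exists_eq_add_of_le hij
      obtain ⟨r, hr⟩ := Q.exists_walk j e
      refine ⟨r.reverse, fun x hx => ?_⟩
      obtain ⟨n, hn, rfl⟩ := hr x (by simpa using hx)
      exact hlate n (by omega)
  obtain ⟨r, hr⟩ := hmid
  obtain ⟨x, hx, hxS⟩ := hsep a ha d hd ((p.append r).append q)
  rw [Walk.mem_support_append_iff, Walk.mem_support_append_iff] at hx
  rcases hx with (hx | hx) | hx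
  · exact hp x hx (Or.inl hxS)
  · exact hr x hx hxS
  · exact hq x hx (Or.inl hxS)

/-- Equivalence of rays as a setoid. -/
def raySetoid {V : Type u} (G : SimpleGraph V) : Setoid G.Ray where
  r := Ray.Equivalent
  iseqv := ⟨Ray.Equivalent.refl, Ray.Equivalent.symm, Ray.Equivalent.trans⟩

/-- The ends of `G`: the equivalence classes of its rays. -/
def RayEnd {V : Type u} (G : SimpleGraph V) : Type u :=
  Quotient G.raySetoid

/-- The end to which a ray belongs. -/
def Ray.toEnd {V : Type u} {G : SimpleGraph V} (R : G.Ray) : G.RayEnd :=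
  Quotient.mk G.raySetoid R

/-- The vertex-degree of an end: the largest cardinality, in `ℕ ∪ {∞}`, of a set of pairwise
(vertex-)disjoint rays of the end. -/
noncomputable def RayEnd.vertexDegree {V : Type u} {G : SimpleGraph V} (ω : G.RayEnd) : ℕ∞ :=
  ⨆ (𝓡 : Set G.Ray) (_ : ∀ R ∈ 𝓡, R.toEnd = ω) (_ : 𝓡.PairwiseDisjoint Ray.verts), 𝓡.encard

/-- A model of `H` as a minor of `G`: pairwise disjoint (nonempty) connected branch sets in `G`, one
for each vertex of `H`, such that `G` has an edge between the branch sets of any two adjacent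
vertices of `H`. The graph `H` is a minor of `G` if and only if such a model exists. -/
structure MinorModel {W : Type v} {V : Type u} (H : SimpleGraph W) (G : SimpleGraph V) where
  branch : W → Set V
  connected : ∀ w, (G.induce (branch w)).Connected
  disjoint : Pairwise fun w w' => Disjoint (branch w) (branch w')
  adj : ∀ w w', H.Adj w w' → ∃ x ∈ branch w, ∃ y ∈ branch w', G.Adj x y

/-- The `[k] × ℕ` grid: `(i, m)` and `(j, n)` are adjacent if they agree in one coordinate and
differ by exactly one in the other. -/
def halfGrid (k : ℕ) : SimpleGraph (Fin k × ℕ) :=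
  pathGraph k □ hasse ℕ

theorem halfGrid_adj {k : ℕ} {p q : Fin k × ℕ} :
    (halfGrid k).Adj p q ↔
      (((p.1 : ℕ) + 1 = q.1 ∨ (q.1 : ℕ) + 1 = p.1) ∧ p.2 = q.2) ∨
        ((p.2 + 1 = q.2 ∨ q.2 + 1 = p.2) ∧ p.1 = q.1) := by
  simp [halfGrid, boxProd_adj, pathGraph_adj, hasse_adj]

end SimpleGraph

namespace SimpleGraph

/-! ### Paths and radius -/

/-! Take `d = ⌈3k/2 - 1⌉` disjoint rays of `ω`. Their ray graph joins two rays when, arbitrarily far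
out, they are linked by paths avoiding the rest of the family; it is connected since the rays are
equivalent. A token moving over the ray graph describes a column of the grid switching from one ray
to another, and two tokens on adjacent vertices can be given an edge between their columns. Since
moves can be undone, it suffices to place `k` tokens in a linear order so that any two consecutive
ones can be brought together, with the help of the others: go there, add the edge, go back, and
repeat for all consecutive pairs, infinitely often.

The combinatorial core, `Connected.exists_linked_tokens`, finds at least `2n/3` such tokens on any
connected graph with `n` vertices. If a longest path has at least `2n/3` vertices, they go along it.
Otherwise the radius is less than `n/3`. In a shortest-path tree rooted at the midpoint `c` of the
path, all vertices get a token except the proper ancestors of a deepest vertex `x₀`; the order is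
depth-first, starting at `x₀`. If `y` follows `x`, the parent of `y` is `x` or an ancestor of `x`.
The free branch above `x₀` is long enough to store the tokens standing above `x`, whereupon the
token of `x` climbs to the parent of `y`.

`HasBlocks` translates token moves into disjoint connected sets of `G`. It composes
(`HasBlocks.trans`), so a full round of moves yields one layer of the grid, and
`HasBlocks.exists_seq` stacks the layers. -/

theorem Walk.IsPath.append_of_inter {V : Type*} {G : SimpleGraph V} {u v w : V} {p : G.Walk u v}
    {q : G.Walk v w} (hp : p.IsPath) (hq : q.IsPath)
    (h : ∀ z ∈ p.support, z ∈ q.support → z = v) : (p.append q).IsPath := by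
  rw [Walk.isPath_def] at *
  rw [Walk.support_append, List.nodup_append']
  have hq' := hq
  rw [← Walk.cons_tail_support q] at hq'
  refine ⟨hp, (List.nodup_cons.1 hq').2, fun z hz hz' => ?_⟩
  have := h z hz (List.mem_of_mem_tail hz')
  subst this
  exact (List.nodup_cons.1 hq').1 hz'

theorem Connected.dist_getVert_le {V : Type*} {G : SimpleGraph V} (hG : G.Connected) {u w : V}
    (p : G.Walk u w) (i t : ℕ) (h : i + t ≤ p.length) :
    G.dist (p.getVert i) (p.getVert (i + t)) ≤ t := by
  induction t with
  | zero => simp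
  | succ t ih =>
    have h1 := ih (by omega)
    have h2 := hG.dist_triangle (u := p.getVert i) (v := p.getVert (i + t))
      (w := p.getVert (i + (t + 1)))
    have h3 : G.dist (p.getVert (i + t)) (p.getVert (i + (t + 1))) = 1 :=
      dist_eq_one_iff_adj.2 (p.adj_getVert_succ (i := i + t) (by omega))
    omega

/-- Every vertex of a connected graph is within distance `(ℓ + 1) / 2` of the midpoint of a longest
path of length `ℓ`. -/
theorem Connected.dist_midpoint_le {V : Type*} {G : SimpleGraph V} (hG : G.Connected) {u w : V}
    {p : G.Walk u w} (hp : p.IsPath)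
    (hmax : ∀ (u' w' : V) (p' : G.Walk u' w'), p'.IsPath → p'.length ≤ p.length) (v : V) :
    G.dist (p.getVert (p.length / 2)) v ≤ (p.length + 1) / 2 := by
  classical
  -- A shortest path from `v` to its nearest vertex `x` on `p` meets `p` only in `x`. Prolonging it
  -- along either part of `p` gives a path, so by maximality `dist v x` is at most the length of
  -- each part.
  obtain ⟨x, hx, hmin⟩ := p.support.toFinset.exists_min_image (fun x => G.dist v x)
    ⟨u, by simp⟩
  simp only [List.mem_toFinset] at hx hmin
  obtain ⟨q, hq, hql⟩ := hG.exists_path_of_dist v x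
  have hinter : ∀ z ∈ q.support, z ∈ p.support → z = x := by
    intro z hz hzp
    have h1 := hmin z hzp
    have h2 := congrArg Walk.length (q.take_spec hz)
    rw [Walk.length_append] at h2
    have h3 := dist_le (q.takeUntil z hz)
    have h4 : (q.dropUntil z hz).length = 0 := by omega
    exact Walk.eq_of_length_eq_zero h4
  have hd := hmax _ _ _ (hq.append_of_inter (hp.dropUntil hx) fun z hz hz' =>
    hinter z hz (p.support_dropUntil_subset_support hx hz'))
  have ht := hmax _ _ _ (hq.append_of_inter (hp.takeUntil hx).reverse fun z hz hz' =>
    hinter z hz (p.support_takeUntil_subset_support hx (by simpa using hz')))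
  have hsum := congrArg Walk.length (p.take_spec hx)
  rw [Walk.length_append] at hsum hd ht
  rw [Walk.length_reverse] at ht
  have hgx : p.getVert (p.takeUntil x hx).length = x := Walk.getVert_length_takeUntil hx
  have htri := hG.dist_triangle (u := p.getVert (p.length / 2)) (v := x) (w := v)
  rw [dist_comm (u := x)] at htri
  rcases le_total (p.length / 2) (p.takeUntil x hx).length with hle | hle
  · obtain ⟨t, ht'⟩ := Nat.exists_eq_add_of_le hle
    have := hG.dist_getVert_le p (p.length / 2) t (by omega)
    rw [← ht', hgx] at this
    omega
  · obtain ⟨t, ht'⟩ := Nat.exists_eq_add_of_le hle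
    have := hG.dist_getVert_le p (p.takeUntil x hx).length t (by omega)
    rw [← ht', hgx, dist_comm] at this
    omega

/-! ### Moving tokens on a graph -/

section Tokens

variable {ι K : Type*} [DecidableEq K] (H : SimpleGraph ι)

/-- A configuration places a token on the vertex `f i`, for each `i`. A step moves one token along
an edge to an unoccupied vertex. -/
def TokenStep (f g : K → ι) : Prop :=
  ∃ i t, H.Adj (f i) t ∧ t ∉ Set.range f ∧ g = Function.update f i t

/-- The second configuration can be reached from the first by token moves. -/
def TokenReach : (K → ι) → (K → ι) → Prop :=
  Relation.ReflTransGen H.TokenStep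

variable {H} {f g : K → ι}

theorem TokenStep.injective (h : H.TokenStep f g) (hf : f.Injective) : g.Injective := by
  obtain ⟨i, t, -, ht, rfl⟩ := h
  intro a b hab
  by_cases ha : a = i <;> by_cases hb : b = i
  · rw [ha, hb]
  · subst ha
    rw [Function.update_self, Function.update_of_ne hb] at hab
    exact absurd ⟨b, hab.symm⟩ ht
  · subst hb
    rw [Function.update_self, Function.update_of_ne ha] at hab
    exact absurd ⟨a, hab⟩ ht
  · rw [Function.update_of_ne ha, Function.update_of_ne hb] at hab
    exact hf hab

theorem TokenStep.symm (h : H.TokenStep f g) (hf : f.Injective) : H.TokenStep g f := by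
  obtain ⟨i, t, hadj, ht, rfl⟩ := h
  refine ⟨i, f i, by simpa using hadj.symm, ?_, by simp⟩
  rintro ⟨j, hj⟩
  by_cases hji : j = i
  · subst hji
    rw [Function.update_self] at hj
    exact hadj.ne hj.symm
  · rw [Function.update_of_ne hji] at hj
    exact hji (hf hj)

theorem TokenReach.injective (h : H.TokenReach f g) (hf : f.Injective) : g.Injective := by
  induction h with
  | refl => exact hf
  | tail _ h ih => exact h.injective ih

theorem TokenReach.symm (h : H.TokenReach f g) (hf : f.Injective) : H.TokenReach g f := by
  induction h with
  | refl => exact Relation.ReflTransGen.refl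
  | tail h' h ih =>
    exact Relation.ReflTransGen.head (h.symm (TokenReach.injective h' hf)) ih

/-- A token can be moved along a walk whose other vertices are unoccupied. -/
theorem TokenReach.update_of_walk (i : K) {s t : ι} (p : H.Walk s t) :
    ∀ g : K → ι, g.Injective → g i = s → (∀ z ∈ p.support, z ≠ s → z ∉ Set.range g) →
      H.TokenReach g (Function.update g i t) := by
  induction p with
  | nil =>
    rintro g - rfl -
    rw [Function.update_eq_self]
    exact Relation.ReflTransGen.refl
  | @cons s v t h q ih =>
    rintro g hg rfl hp
    have hv : v ∉ Set.range g := hp v (by simp) h.ne'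
    have hstep : H.TokenStep g (Function.update g i v) := ⟨i, v, h, hv, rfl⟩
    have := ih (Function.update g i v) (hstep.injective hg) (by simp) ?_
    · rw [Function.update_idem] at this
      exact Relation.ReflTransGen.head hstep this
    · rintro z hz hzv ⟨j, rfl⟩
      by_cases hj : j = i
      · subst hj
        simp at hzv
      · rw [Function.update_of_ne hj] at hz
        exact hp (g j) (by simp [hz]) (fun h => hj (hg h)) ⟨j, rfl⟩

end Tokens

/-! ### Depth-first order of a rooted tree given by its parent function -/

section Parent

variable {ι : Type*} {H : SimpleGraph ι}

/-- A function mapping each vertex other than `c` to a neighbour closer to `c`. -/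
structure IsParent (H : SimpleGraph ι) (c : ι) (par : ι → ι) : Prop where
  root : par c = c
  adj : ∀ v, v ≠ c → H.Adj (par v) v
  dist : ∀ v, H.dist c (par v) = H.dist c v - 1

theorem Connected.exists_isParent (hH : H.Connected) (c : ι) : ∃ par, IsParent H c par := by
  classical
  have : ∀ v, ∃ w, (v = c → w = c) ∧ (v ≠ c → H.Adj w v) ∧ H.dist c w = H.dist c v - 1 := by
    intro v
    by_cases hv : v = c
    · exact ⟨c, fun _ => rfl, fun h => absurd hv h, by simp [hv]⟩
    · obtain ⟨p, hp⟩ := hH.exists_walk_length_eq_dist c v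
      have hn : ¬ p.Nil := fun h => hv h.eq.symm
      refine ⟨p.penultimate, fun h => absurd h hv, fun _ => p.adj_penultimate hn, ?_⟩
      have h1 := dist_le p.dropLast
      have h2 := hH.dist_triangle (u := c) (v := p.penultimate) (w := v)
      have h3 := dist_eq_one_iff_adj.2 (p.adj_penultimate hn)
      have h4 : p.dropLast.length = p.length - 1 := by simp
      have h5 := hH.pos_dist_of_ne (Ne.symm hv)
      omega
  choose par h1 h2 h3 using this
  exact ⟨par, h1 c rfl, h2, h3⟩

variable {c : ι} {par : ι → ι}

namespace IsParent

theorem dist_iterate (h : IsParent H c par) (v : ι) (i : ℕ) :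
    H.dist c (par^[i] v) = H.dist c v - i := by
  induction i with
  | zero => simp
  | succ i ih => rw [Function.iterate_succ_apply', h.dist, ih]; omega

theorem iterate_eq_root (h : IsParent H c par) (hH : H.Connected) {v : ι} {i : ℕ}
    (hi : H.dist c v ≤ i) : par^[i] v = c := by
  have := h.dist_iterate v i
  rw [Nat.sub_eq_zero_of_le hi] at this
  exact (hH.dist_eq_zero_iff.1 this).symm

theorem exists_walk (h : IsParent H c par) (v : ι) (i : ℕ) :
    ∃ p : H.Walk v (par^[i] v), ∀ z ∈ p.support, ∃ l ≤ i, z = par^[l] v := by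
  induction i with
  | zero => exact ⟨Walk.nil, fun z hz => ⟨0, le_rfl, by simpa using hz⟩⟩
  | succ i ih =>
    obtain ⟨p, hp⟩ := ih
    rw [Function.iterate_succ_apply']
    by_cases hc : par^[i] v = c
    · rw [hc, h.root]
      exact ⟨p.copy rfl hc, fun z hz => by
        obtain ⟨l, hl, rfl⟩ := hp z (by simpa using hz)
        exact ⟨l, by omega, rfl⟩⟩
    · refine ⟨p.concat (h.adj _ hc).symm, fun z hz => ?_⟩
      rw [Walk.support_concat] at hz
      simp only [List.mem_append, List.mem_singleton] at hz
      rcases hz with hz | rfl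
      · obtain ⟨l, hl, rfl⟩ := hp z hz
        exact ⟨l, by omega, rfl⟩
      · exact ⟨i + 1, le_rfl, (Function.iterate_succ_apply' _ _ _).symm⟩

end IsParent

end Parent

section DepthFirst

variable {ι : Type*} {H : SimpleGraph ι} {c : ι} {par : ι → ι}

/-- The proper ancestors of `x` with respect to the parent function `par`. -/
def properAncestors (par : ι → ι) (x : ι) : Set ι :=
  {z | ∃ i, 1 ≤ i ∧ z = par^[i] x}

theorem parent_mem_properAncestors {x z : ι} (h : z ∈ properAncestors par x) :
    par z ∈ properAncestors par x := by
  obtain ⟨i, -, rfl⟩ := h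
  exact ⟨i + 1, by omega, (Function.iterate_succ_apply' _ _ _).symm⟩

/-- The nonempty list `l`, read from its end to its start, begins a depth-first search which has
already visited the proper ancestors of `x₀`. -/
structure IsDepthFirst (par : ι → ι) (x₀ : ι) (l : List ι) : Prop where
  nodup : l.Nodup
  notMem : ∀ z ∈ l, z ∉ properAncestors par x₀
  isChain : l.IsChain fun y x => (∃ i, par y = par^[i] x) ∧ ∀ i, y ≠ par^[i] x
  closed : ∀ z ∈ l, par z ∈ properAncestors par x₀ ∨ par z ∈ l
  head : ∃ x ∈ l.head?, ∀ z, z ∉ properAncestors par x₀ → z ∉ l →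
    (par z ∈ properAncestors par x₀ ∨ par z ∈ l) → ∃ i, par z = par^[i] x

namespace IsParent

theorem isDepthFirst_singleton (h : IsParent H c par) {x₀ : ι} (hx₀ : 0 < H.dist c x₀) :
    IsDepthFirst par x₀ [x₀] where
  nodup := by simp
  notMem := by
    rintro z hz ⟨i, hi, hzi⟩
    rw [List.mem_singleton] at hz
    subst hz
    have := h.dist_iterate z i
    rw [← hzi] at this
    omega
  isChain := by simp
  closed := by
    rintro z hz
    rw [List.mem_singleton] at hz
    subst hz
    exact Or.inl ⟨1, le_rfl, rfl⟩
  head := by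
    refine ⟨x₀, by simp, fun z _ _ hz => ?_⟩
    rcases hz with ⟨i, -, hi⟩ | hz
    · exact ⟨i, hi⟩
    · exact ⟨0, by simpa using hz⟩

/-- The next vertex `y` is a deepest unvisited one with a visited parent. The invariant `head` says
that the parents of all such candidates lie on the chain from the last vertex up to the root;
choosing the deepest makes it survive. -/
theorem exists_isDepthFirst_cons [Finite ι] (h : IsParent H c par) (hH : H.Connected) {x₀ : ι}
    {l : List ι} (hl : IsDepthFirst par x₀ l) (hz : ∃ z, z ∉ properAncestors par x₀ ∧ z ∉ l) :
    ∃ y, IsDepthFirst par x₀ (y :: l) := by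
  set S := properAncestors par x₀ with hS
  have hup : ∀ i z, (z ∈ S ∨ z ∈ l) → (par^[i] z ∈ S ∨ par^[i] z ∈ l) := by
    intro i z hz
    induction i with
    | zero => exact hz
    | succ i ih =>
      rw [Function.iterate_succ_apply']
      rcases ih with ih | ih
      · exact Or.inl (parent_mem_properAncestors ih)
      · exact hl.closed _ ih
  have hroot : c ∈ S ∨ c ∈ l := by
    obtain ⟨x, hx, -⟩ := hl.head
    have := hup (H.dist c x) x (Or.inr (List.mem_of_mem_head? hx))
    rwa [h.iterate_eq_root hH le_rfl] at this
  -- An unvisited vertex closest to the root has a visited parent, so there is a candidate.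
  obtain ⟨z, ⟨hzS, hzl⟩, hzmin⟩ := Set.exists_min_image {z | z ∉ S ∧ z ∉ l} (fun z => H.dist c z)
    (Set.toFinite _) hz
  have hzpar : par z ∈ S ∨ par z ∈ l := by
    by_contra hcon
    rw [not_or] at hcon
    have h1 := hzmin _ hcon
    rw [h.dist] at h1
    have h2 : H.dist c z = 0 := by omega
    have h3 := hH.dist_eq_zero_iff.1 h2
    subst h3
    rcases hroot with h4 | h4
    · exact hzS h4
    · exact hzl h4
  obtain ⟨y, ⟨hyS, hyl, hyp⟩, hymax⟩ := Set.exists_max_image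
    {z | z ∉ S ∧ z ∉ l ∧ (par z ∈ S ∨ par z ∈ l)} (fun z => H.dist c z) (Set.toFinite _)
    ⟨z, hzS, hzl, hzpar⟩
  obtain ⟨x, hx, hxl⟩ := hl.head
  refine ⟨y, List.nodup_cons.2 ⟨hyl, hl.nodup⟩, ?_, ?_, ?_, ⟨y, by simp, ?_⟩⟩
  · rintro w hw
    rcases List.mem_cons.1 hw with rfl | hw
    · exact hyS
    · exact hl.notMem w hw
  · refine hl.isChain.cons fun x' hx' => ?_
    obtain rfl : x' = x := Option.mem_unique hx' hx
    refine ⟨hxl y hyS hyl hyp, fun i hi => ?_⟩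
    have := hup i x' (Or.inr (List.mem_of_mem_head? hx))
    rw [← hi] at this
    exact this.elim hyS hyl
  · rintro w hw
    rcases List.mem_cons.1 hw with rfl | hw
    · exact hyp.imp_right (List.mem_cons_of_mem _)
    · exact (hl.closed w hw).imp_right (List.mem_cons_of_mem _)
  · intro w hwS hwl hwp
    rw [List.mem_cons, not_or] at hwl
    have hcase : par w = y ∨ (par w ∈ S ∨ par w ∈ l) := by
      rcases hwp with hwp | hwp
      · exact Or.inr (Or.inl hwp)
      · exact (List.mem_cons.1 hwp).imp_right Or.inr
    rcases hcase with hwy | hwp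
    · exact ⟨0, hwy⟩
    · obtain ⟨a, ha⟩ := hxl w hwS hwl.2 hwp
      obtain ⟨b, hb⟩ := hxl y hyS hyl hyp
      have hd := hymax w ⟨hwS, hwl.2, hwp⟩
      have hd1 := h.dist w
      have hd2 := h.dist y
      rcases le_total b a with hab | hab
      · obtain ⟨e, rfl⟩ := Nat.exists_eq_add_of_le' hab
        refine ⟨e + 1, ?_⟩
        rw [ha, Function.iterate_add_apply, ← hb, Function.iterate_succ_apply]
      · obtain ⟨e, rfl⟩ := Nat.exists_eq_add_of_le' hab
        have hpe : par y = par^[e] (par w) := by rw [hb, ha, Function.iterate_add_apply]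
        rcases Nat.eq_zero_or_pos e with rfl | he
        · exact ⟨1, hpe.symm⟩
        -- Here `par y` would lie above `par w` although `w` is no deeper than `y`. This happens
        -- only if both parents are the root, where iterates of `par` stay.
        · have h1 := h.dist_iterate (par w) e
          rw [← hpe] at h1
          have h2 : H.dist c (par w) = 0 := by omega
          have h3 : H.dist c (par y) = 0 := by omega
          exact ⟨1, ((hH.dist_eq_zero_iff.1 h2).symm.trans (hH.dist_eq_zero_iff.1 h3))⟩

theorem exists_isDepthFirst_covering [Finite ι] (h : IsParent H c par) (hH : H.Connected) {x₀ : ι}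
    (hx₀ : 0 < H.dist c x₀) :
    ∃ l, IsDepthFirst par x₀ l ∧ ∀ z, z ∉ properAncestors par x₀ → z ∈ l := by
  classical
  have := Fintype.ofFinite ι
  have key : ∀ m : ℕ, ∃ l, IsDepthFirst par x₀ l ∧
      ((∀ z, z ∉ properAncestors par x₀ → z ∈ l) ∨ m ≤ l.length) := by
    intro m
    induction m with
    | zero => exact ⟨[x₀], h.isDepthFirst_singleton hx₀, Or.inr (Nat.zero_le _)⟩
    | succ m ih =>
      obtain ⟨l, hl, hm⟩ := ih
      by_cases hz : ∃ z, z ∉ properAncestors par x₀ ∧ z ∉ l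
      · obtain ⟨y, hy⟩ := h.exists_isDepthFirst_cons hH hl hz
        rcases hm with hm | hm
        · obtain ⟨z, hz, hz'⟩ := hz
          exact absurd (hm z hz) hz'
        · exact ⟨_, hy, Or.inr (by simpa using hm)⟩
      · push Not at hz
        exact ⟨l, hl, Or.inl hz⟩
  obtain ⟨l, hl, hm⟩ := key (Fintype.card ι + 1)
  rcases hm with hm | hm
  · exact ⟨l, hl, hm⟩
  · have := hl.nodup.length_le_card
    omega

end IsParent

end DepthFirst

/-! ### Parking tokens on a free branch of the tree -/

section Parking

variable {ι K : Type*} [DecidableEq K] {H : SimpleGraph ι} {c : ι} {par : ι → ι}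

theorem notMem_range_update {g : K → ι} {i : K} {t z : ι} (hzt : z ≠ t)
    (hz : ∀ j, j ≠ i → g j ≠ z) : z ∉ Set.range (Function.update g i t) := by
  rintro ⟨j, rfl⟩
  by_cases hj : j = i
  · subst hj
    simp at hzt
  · exact hz j hj (by rw [Function.update_of_ne hj])

/-- If exactly the proper ancestors of a deepest vertex `x₀` are unoccupied, then the proper
ancestors of any vertex `x` can be vacated without moving any other token. -/
theorem IsParent.exists_tokenReach_vacate (h : IsParent H c par) (hH : H.Connected) {x₀ : ι}
    (hx₀ : ∀ v, H.dist c v ≤ H.dist c x₀) (hpos : 0 < H.dist c x₀) {f : K → ι}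
    (hf : f.Injective) (hrange : ∀ v, v ∈ Set.range f ↔ v ∉ properAncestors par x₀) (x : ι)
    (hx : x ∉ properAncestors par x₀) :
    ∃ g, H.TokenReach f g ∧ (∀ i, 1 ≤ i → par^[i] x ∉ Set.range g) ∧
      ∀ i, (∀ l, 1 ≤ l → f i ≠ par^[l] x) → g i = f i := by
  classical
  set S := properAncestors par x₀ with hS
  have hcS : c ∈ S := ⟨H.dist c x₀, hpos, (h.iterate_eq_root hH le_rfl).symm⟩
  -- `m` is the number of steps from `x` up to its first ancestor on the free branch, and `j` below
  -- is the number of steps from `x₀` up to the same vertex.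
  have hex : ∃ m, par^[m] x ∈ S := ⟨H.dist c x, by rwa [h.iterate_eq_root hH le_rfl]⟩
  obtain ⟨m, hm, hmin⟩ : ∃ m, par^[m] x ∈ S ∧ ∀ q < m, par^[q] x ∉ S :=
    ⟨Nat.find hex, Nat.find_spec hex, fun q hq => Nat.find_min hex hq⟩
  have hmD : m ≤ H.dist c x := by
    by_contra hcon
    refine hmin (H.dist c x) (by omega) ?_
    rwa [h.iterate_eq_root hH le_rfl]
  have hm0 : 0 < m := by
    rcases Nat.eq_zero_or_pos m with rfl | h0
    · exact absurd hm hx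
    · exact h0
  -- `m ≤ j` because `x₀` is deepest. Hence the free branch has room below the meeting vertex for
  -- the `m - 1` tokens strictly between `x` and that vertex.
  obtain ⟨j, hj, hjm, hjρ⟩ : ∃ j, par^[m] x = par^[j] x₀ ∧ m ≤ j ∧ j ≤ H.dist c x₀ := by
    have h1 := h.dist_iterate x m
    have h2 := hx₀ x
    obtain ⟨j, -, hj⟩ := hm
    rcases le_total j (H.dist c x₀) with hle | hle
    · have h3 := h.dist_iterate x₀ j
      rw [← hj] at h3
      exact ⟨j, hj, by omega, hle⟩
    · refine ⟨H.dist c x₀, ?_, by omega, le_rfl⟩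
      rw [hj, h.iterate_eq_root hH hle, h.iterate_eq_root hH le_rfl]
  -- After `r` moves the `r` tokens nearest the meeting vertex are parked at `par^[1] x₀`, …,
  -- `par^[r] x₀`. Handling tokens from the top and filling places from the bottom keeps each walk,
  -- up to the meeting vertex and down again, unobstructed.
  have key : ∀ r, r < m → ∃ g, H.TokenReach f g ∧
      (∀ i, r + 1 ≤ i → par^[i] x₀ ∉ Set.range g) ∧
      (∀ q, m - r ≤ q → q < m → par^[q] x ∉ Set.range g) ∧
      (∀ i, (∀ q, m - r ≤ q → q < m → f i ≠ par^[q] x) → g i = f i) := by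
    intro r
    induction r with
    | zero =>
      intro _
      refine ⟨f, Relation.ReflTransGen.refl, fun i hi hmem => ?_, fun q h1 h2 => by omega,
        fun _ _ => rfl⟩
      exact (hrange _).1 hmem ⟨i, hi, rfl⟩
    | succ r ih =>
      intro hr
      obtain ⟨g, hg, hg1, hg2, hg3⟩ := ih (by omega)
      have hgi := hg.injective hf
      obtain ⟨i₀, hi₀⟩ := (hrange (par^[m - (r + 1)] x)).2 (hmin _ (by omega))
      have hgi₀ : g i₀ = par^[m - (r + 1)] x := by
        rw [hg3 i₀, hi₀]
        intro q hq1 hq2 heq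
        have h1 := h.dist_iterate x q
        have h2 := h.dist_iterate x (m - (r + 1))
        rw [← heq, hi₀] at h1
        omega
      obtain ⟨p, hp⟩ := h.exists_walk (par^[m - (r + 1)] x) (r + 1)
      obtain ⟨p', hp'⟩ := h.exists_walk (par^[r + 1] x₀) (j - (r + 1))
      have hend : par^[r + 1] (par^[m - (r + 1)] x) = par^[j - (r + 1)] (par^[r + 1] x₀) := by
        rw [← Function.iterate_add_apply, ← Function.iterate_add_apply,
          show r + 1 + (m - (r + 1)) = m by omega, show j - (r + 1) + (r + 1) = j by omega, hj]
      have hmove := TokenReach.update_of_walk i₀ ((p.copy rfl hend).append p'.reverse) g hgi hgi₀ ?_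
      · refine ⟨_, hg.trans hmove, fun i hi => notMem_range_update ?_ ?_,
          fun q hq1 hq2 => notMem_range_update ?_ ?_, fun i hi => ?_⟩
        · intro heq
          have h1 := h.dist_iterate x₀ i
          have h2 := h.dist_iterate x₀ (r + 1)
          rw [heq] at h1
          omega
        · exact fun i' _ hi' => hg1 i (by omega) ⟨i', hi'⟩
        · exact fun heq => hmin q hq2 ⟨r + 1, by omega, heq⟩
        · intro i' hi' heq
          rcases Nat.lt_or_ge q (m - r) with hlt | hge
          · obtain rfl : q = m - (r + 1) := by omega
            exact hi' (hgi (heq.trans hgi₀.symm))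
          · exact hg2 q hge hq2 ⟨i', heq⟩
        · have hne : i ≠ i₀ := by
            rintro rfl
            exact hi _ le_rfl (by omega) hi₀
          rw [Function.update_of_ne hne]
          exact hg3 i fun q hq1 hq2 => hi q (by omega) hq2
      · intro z hz hzne
        rw [Walk.mem_support_append_iff, Walk.support_copy, Walk.support_reverse,
          List.mem_reverse] at hz
        rcases hz with hz | hz
        · obtain ⟨l, hl, rfl⟩ := hp z hz
          have hl0 : l ≠ 0 := by
            rintro rfl
            exact hzne rfl
          rw [← Function.iterate_add_apply]
          rcases Nat.lt_or_ge l (r + 1) with hlt | hge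
          · exact hg2 _ (by omega) (by omega)
          · rw [show l + (m - (r + 1)) = m by omega, hj]
            exact hg1 j (by omega)
        · obtain ⟨l, hl, rfl⟩ := hp' z hz
          rw [← Function.iterate_add_apply]
          exact hg1 _ (by omega)
  obtain ⟨g, hg, hg1, hg2, hg3⟩ := key (m - 1) (by omega)
  refine ⟨g, hg, fun i hi => ?_, fun i hi => hg3 i fun q hq1 hq2 => hi q (by omega)⟩
  rcases Nat.lt_or_ge i m with hlt | hge
  · exact hg2 i (by omega) hlt
  · obtain ⟨e, rfl⟩ := Nat.exists_eq_add_of_le' hge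
    rw [Function.iterate_add_apply, hj, ← Function.iterate_add_apply]
    exact hg1 _ (by omega)

/-- Consecutive vertices of a depth-first order can be brought together. -/
theorem IsParent.exists_tokenReach_adj (h : IsParent H c par) (hH : H.Connected) {x₀ : ι}
    (hx₀ : ∀ v, H.dist c v ≤ H.dist c x₀) (hpos : 0 < H.dist c x₀) {f : K → ι}
    (hf : f.Injective) (hrange : ∀ v, v ∈ Set.range f ↔ v ∉ properAncestors par x₀) {a b : K}
    (hab : (∃ i, par (f b) = par^[i] (f a)) ∧ ∀ i, f b ≠ par^[i] (f a)) :
    ∃ g, H.TokenReach f g ∧ H.Adj (g a) (g b) := by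
  obtain ⟨g, hg, hg1, hg2⟩ := h.exists_tokenReach_vacate hH hx₀ hpos hf hrange (f a)
    ((hrange _).1 ⟨a, rfl⟩)
  obtain ⟨⟨i, hi⟩, hne⟩ := hab
  have hga : g a = f a := by
    -- Only the root is its own proper ancestor, as `par c = c`, and the root carries no token.
    refine hg2 a fun l hl heq => ?_
    have h1 := h.dist_iterate (f a) l
    rw [← heq] at h1
    have h2 : H.dist c (f a) = 0 := by omega
    have h3 := hH.dist_eq_zero_iff.1 h2
    exact (hrange c).1 ⟨a, h3.symm⟩
      ⟨H.dist c x₀, hpos, (h.iterate_eq_root hH le_rfl).symm⟩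
  have hgb : g b = f b := hg2 b fun l _ => hne l
  have hbc : f b ≠ c := by
    rw [← h.iterate_eq_root hH (le_refl (H.dist c (f a)))]
    exact hne _
  obtain ⟨p, hp⟩ := h.exists_walk (f a) i
  refine ⟨_, hg.trans (TokenReach.update_of_walk a p g (hg.injective hf) hga ?_), ?_⟩
  · intro z hz hza
    obtain ⟨l, hl, rfl⟩ := hp z hz
    refine hg1 l (Nat.pos_of_ne_zero ?_)
    rintro rfl
    exact hza rfl
  · have hba : b ≠ a := by
      rintro rfl
      exact hne 0 rfl
    rw [Function.update_self, Function.update_of_ne hba, hgb, ← hi]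
    exact h.adj _ hbc

end Parking

/-- On a connected graph with `n` vertices one can place at least `2n/3` tokens, in a linear order,
such that any two consecutive tokens can be moved to adjacent vertices. -/
theorem Connected.exists_linked_tokens {ι : Type*} [Fintype ι] {H : SimpleGraph ι}
    (hH : H.Connected) :
    ∃ (k : ℕ) (f : Fin k → ι), 2 * Fintype.card ι ≤ 3 * k ∧ f.Injective ∧
      ∀ a b : Fin k, (a : ℕ) + 1 = b →
        ∃ g, H.TokenReach f g ∧ H.Adj (g a) (g b) := by
  classical
  have := hH.nonempty
  obtain ⟨u, w, p, hp, hmax⟩ := Walk.exists_isPath_forall_isPath_length_le_length H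
  by_cases hlong : 2 * Fintype.card ι ≤ 3 * (p.length + 1)
  · refine ⟨p.length + 1, fun i => p.getVert i, hlong, fun i j hij => ?_, fun a b hab => ?_⟩
    · exact Fin.ext (hp.getVert_injOn (by simpa using Nat.lt_succ_iff.1 i.2)
        (by simpa using Nat.lt_succ_iff.1 j.2) hij)
    · refine ⟨_, Relation.ReflTransGen.refl, ?_⟩
      show H.Adj (p.getVert a) (p.getVert b)
      rw [← hab]
      exact p.adj_getVert_succ (by omega)
  · obtain ⟨x₀, hx₀⟩ := Finite.exists_max fun v => H.dist (p.getVert (p.length / 2)) v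
    have hd := hH.dist_midpoint_le hp (fun u' w' p' => hmax u' w' p') x₀
    set c := p.getVert (p.length / 2) with hc
    obtain ⟨par, hpar⟩ := hH.exists_isParent c
    have hpos : 0 < H.dist c x₀ := by
      by_contra hcon
      have hall : ∀ v, v = c := fun v => by
        have := hx₀ v
        exact (hH.dist_eq_zero_iff.1 (show H.dist c v = 0 by omega)).symm
      have : Fintype.card ι ≤ 1 := Fintype.card_le_one_iff.2 fun a b => by
        rw [hall a, hall b]
      omega
    obtain ⟨l, hl, hcov⟩ := hpar.exists_isDepthFirst_covering hH hpos
    have hrev : (l.reverse).Nodup := List.nodup_reverse.2 hl.nodup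
    have hrange : ∀ v, v ∈ Set.range l.reverse.get ↔ v ∉ properAncestors par x₀ := by
      intro v
      rw [Set.mem_range, ← List.mem_iff_get, List.mem_reverse]
      exact ⟨hl.notMem v, hcov v⟩
    refine ⟨l.reverse.length, l.reverse.get, ?_, List.nodup_iff_injective_get.1 hrev, ?_⟩
    -- Only `H.dist c x₀` vertices stay free, and the short longest path makes this less than a
    -- third of all.
    · have hcard : Fintype.card ι ≤ l.length + H.dist c x₀ := by
        have hsub : (Finset.univ : Finset ι) ⊆
            l.toFinset ∪ (Finset.Icc 1 (H.dist c x₀)).image fun i => par^[i] x₀ := by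
          intro v _
          rw [Finset.mem_union, List.mem_toFinset]
          by_cases hv : v ∈ properAncestors par x₀
          · right
            obtain ⟨i, hi, rfl⟩ := hv
            rw [Finset.mem_image]
            rcases le_total i (H.dist c x₀) with hle | hle
            · exact ⟨i, Finset.mem_Icc.2 ⟨hi, hle⟩, rfl⟩
            · exact ⟨H.dist c x₀, Finset.mem_Icc.2 ⟨hpos, le_rfl⟩, by
                rw [hpar.iterate_eq_root hH hle, hpar.iterate_eq_root hH le_rfl]⟩
          · exact Or.inl (hcov v hv)
        have h1 := (Finset.card_le_card hsub).trans (Finset.card_union_le _ _)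
        have h2 := l.toFinset_card_le
        have h3 := Finset.card_image_le (s := Finset.Icc 1 (H.dist c x₀))
          (f := fun i => par^[i] x₀)
        rw [Nat.card_Icc] at h3
        rw [Finset.card_univ] at h1
        omega
      rw [List.length_reverse]
      omega
    · intro a b hab
      refine hpar.exists_tokenReach_adj hH hx₀ hpos (List.nodup_iff_injective_get.1 hrev) hrange ?_
      have hchain := List.isChain_iff_getElem.1 (List.isChain_reverse.2 hl.isChain) a
        (by rw [hab]; exact b.2)
      simp only [hab] at hchain
      exact hchain

/-! ### Connected vertex sets and subwalks -/

section Connect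

variable {V : Type*} {G : SimpleGraph V}

theorem connected_induce_singleton (v : V) : (G.induce {v}).Connected := by
  simp

theorem connected_induce_insert {v w : V} {s : Set V} (hs : (G.induce s).Connected) (hw : w ∈ s)
    (h : G.Adj v w) : (G.induce (insert v s)).Connected := by
  rw [Set.insert_eq]
  exact connected_induce_union (connected_induce_singleton v).preconnected hs.preconnected
    (Set.mem_singleton v) hw h

theorem Ray.connected_segment (R : G.Ray) (a d : ℕ) :
    (G.induce (R.vert '' Set.Icc a (a + d))).Connected := by
  induction d with
  | zero =>
    rw [Nat.add_zero, Set.Icc_self, Set.image_singleton]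
    exact connected_induce_singleton (R.vert a)
  | succ d ih =>
    have : R.vert '' Set.Icc a (a + (d + 1)) =
        insert (R.vert (a + d + 1)) (R.vert '' Set.Icc a (a + d)) := by
      rw [← Set.image_insert_eq]
      congr 1
      ext x
      simp only [Set.mem_Icc, Set.mem_insert_iff]
      omega
    rw [this]
    exact connected_induce_insert ih ⟨a + d, by simp, rfl⟩ (R.adj _).symm

/-- A walk between distinct vertices contains a connected set avoiding its last vertex, but
containing its first vertex and a neighbour of the last one. -/
theorem Walk.exists_connected_init {x y : V} (p : G.Walk x y) (hxy : x ≠ y) :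
    ∃ W : Set V, W.Finite ∧ (G.induce W).Connected ∧ x ∈ W ∧ y ∉ W ∧
      (∀ z ∈ W, z ∈ p.support) ∧ ∃ w ∈ W, G.Adj w y := by
  induction p with
  | nil => exact absurd rfl hxy
  | @cons x v y h q ih =>
    by_cases hv : v = y
    · subst hv
      exact ⟨{x}, Set.finite_singleton x, connected_induce_singleton x, rfl,
        fun h => hxy h.symm, fun z hz => by simp [Set.mem_singleton_iff.1 hz], x, rfl, h⟩
    · obtain ⟨W, hfin, hW, hvW, hyW, hsub, w, hw, hwy⟩ := ih hv
      refine ⟨insert x W, hfin.insert x, connected_induce_insert hW hvW h, Set.mem_insert _ _, ?_,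
        ?_, w, Set.mem_insert_of_mem _ hw, hwy⟩
      · rw [Set.mem_insert_iff, not_or]
        exact ⟨hxy.symm, hyW⟩
      · rintro z (rfl | hz)
        · simp
        · simp [hsub z hz]

/-- A walk ending in `B` contains a walk from `A` to `B` all of whose inner vertices avoid
`A ∪ B`, or it starts with a walk to `B` which avoids `A` and whose inner vertices avoid `B`. -/
theorem Walk.exists_subwalk_inter {A B : Set V} (hAB : Disjoint A B) {x y : V} (p : G.Walk x y)
    (hy : y ∈ B) :
    (∃ x' ∈ A, ∃ y' ∈ B, ∃ q : G.Walk x' y', ∀ z ∈ q.support, z ∈ p.support ∧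
      (z ∈ A ∪ B → z = x' ∨ z = y')) ∨
    (x ∉ A ∧ ∃ y' ∈ B, ∃ q : G.Walk x y', ∀ z ∈ q.support, z ∈ p.support ∧
      (z ∈ A ∪ B → z = y')) := by
  induction p with
  | nil =>
    exact Or.inr ⟨fun h => hAB.le_bot ⟨h, hy⟩, _, hy, Walk.nil, by simp⟩
  | @cons x v y h p ih =>
    rcases ih hy with ⟨x', hx', y', hy', q, hq⟩ | ⟨hv, y', hy', q, hq⟩
    · exact Or.inl ⟨x', hx', y', hy', q, fun z hz =>
        ⟨by simp [(hq z hz).1], (hq z hz).2⟩⟩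
    · by_cases hxA : x ∈ A
      · refine Or.inl ⟨x, hxA, y', hy', Walk.cons h q, fun z hz => ?_⟩
        rw [Walk.support_cons, List.mem_cons] at hz
        rcases hz with rfl | hz
        · simp
        · exact ⟨by simp [(hq z hz).1], fun hzA => Or.inr ((hq z hz).2 hzA)⟩
      · by_cases hxB : x ∈ B
        · exact Or.inr ⟨hxA, x, hxB, Walk.nil, by simp⟩
        · refine Or.inr ⟨hxA, y', hy', Walk.cons h q, fun z hz => ?_⟩
          rw [Walk.support_cons, List.mem_cons] at hz
          rcases hz with rfl | hz
          · simp [hxA, hxB]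
          · exact ⟨by simp [(hq z hz).1], (hq z hz).2⟩

end Connect

/-! ### The ray graph -/

section RayGraph

variable {V ι : Type*} {G : SimpleGraph V}

/-- The ray graph of a family of rays: two rays are adjacent if, outside every finite set, they are
joined by a walk whose inner vertices avoid all rays of the family. -/
def rayGraph (R : ι → G.Ray) : SimpleGraph ι where
  Adj s t := s ≠ t ∧ ∀ X : Set V, X.Finite → ∃ x ∈ (R s).verts, ∃ y ∈ (R t).verts,
    ∃ p : G.Walk x y, ∀ z ∈ p.support, z ∉ X ∧ ∀ u, z ∈ (R u).verts → z = x ∨ z = y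
  symm := ⟨by
    rintro s t ⟨hst, h⟩
    refine ⟨hst.symm, fun X hX => ?_⟩
    obtain ⟨x, hx, y, hy, p, hp⟩ := h X hX
    exact ⟨y, hy, x, hx, p.reverse, fun z hz =>
      ⟨(hp z (by simpa using hz)).1, fun u hu => ((hp z (by simpa using hz)).2 u hu).symm⟩⟩⟩
  loopless := ⟨fun s h => h.1 rfl⟩

/-- If `t` were unreachable from `s`, each pair of a reachable and an unreachable ray would have a
finite set meeting all its direct connections. The union of these sets would separate `R s` from `R
t`, since a walk between the two classes of rays contains a direct connection. -/
theorem rayGraph_connected [Finite ι] [Nonempty ι] {R : ι → G.Ray}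
    (hdisj : Pairwise fun s t => Disjoint (R s).verts (R t).verts)
    (heq : ∀ s t, (R s).Equivalent (R t)) : (rayGraph R).Connected := by
  refine (connected_iff _).2 ⟨fun s t => ?_, inferInstance⟩
  by_contra hst
  have hX : ∀ u v, ∃ X : Set V, X.Finite ∧ ((rayGraph R).Reachable s u →
      ¬ (rayGraph R).Reachable s v → ¬ ∃ x ∈ (R u).verts, ∃ y ∈ (R v).verts,
      ∃ p : G.Walk x y, ∀ z ∈ p.support, z ∉ X ∧ ∀ w, z ∈ (R w).verts → z = x ∨ z = y) := by
    intro u v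
    by_cases huv : (rayGraph R).Reachable s u ∧ ¬ (rayGraph R).Reachable s v
    · by_contra hcon
      push Not at hcon
      have hadj : (rayGraph R).Adj u v := by
        refine ⟨?_, fun X hX => (hcon X hX).2.2⟩
        rintro rfl
        exact huv.2 huv.1
      exact huv.2 (huv.1.trans hadj.reachable)
    · exact ⟨∅, Set.finite_empty, fun h1 h2 => absurd ⟨h1, h2⟩ huv⟩
  choose X hXfin hX using hX
  set A : Set V := {z | ∃ u, (rayGraph R).Reachable s u ∧ z ∈ (R u).verts} with hA
  set B : Set V := {z | ∃ u, ¬ (rayGraph R).Reachable s u ∧ z ∈ (R u).verts} with hB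
  have hAB : Disjoint A B := by
    rw [Set.disjoint_left]
    rintro z ⟨u, hu, hzu⟩ ⟨v, hv, hzv⟩
    have huv : u ≠ v := by
      rintro rfl
      exact hv hu
    exact (hdisj huv).le_bot ⟨hzu, hzv⟩
  have hsep := heq s t (⋃ u, ⋃ v, X u v)
    (Set.finite_iUnion fun u => Set.finite_iUnion fun v => hXfin u v)
  simp only [Separates, not_forall] at hsep
  obtain ⟨a, ha, b, hb, p, hp⟩ := hsep
  push Not at hp
  rcases p.exists_subwalk_inter hAB ⟨t, hst, hb⟩ with
    ⟨x, ⟨u, hu, hxu⟩, y, ⟨v, hv, hyv⟩, q, hq⟩ | ⟨haA, -⟩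
  · refine hX u v hu hv ⟨x, hxu, y, hyv, q, fun z hz => ⟨fun hzX => ?_, fun w hw => ?_⟩⟩
    · exact hp z (hq z hz).1 (Set.mem_iUnion₂.2 ⟨u, v, hzX⟩)
    · refine (hq z hz).2 ?_
      by_cases hsw : (rayGraph R).Reachable s w
      · exact Or.inl ⟨w, hsw, hw⟩
      · exact Or.inr ⟨w, hsw, hw⟩
  · exact haA ⟨s, Reachable.refl s, ha⟩

end RayGraph

/-! ### Realising token moves by connected sets -/

section Block

variable {V ι K : Type*} {G : SimpleGraph V}

/-- Far out along the rays `R`, there are disjoint finite connected sets `D i` which contain paths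
from the rays `R (f i)` to the rays `R (g i)`, and which have edges between `D i` and `D j` whenever
`A i j` holds. The sets avoid `X`, start at the indices `a`, and avoid all rays after the
indices `b`. -/
def HasBlocks (R : ι → G.Ray) (A : K → K → Prop) (f g : K → ι) : Prop :=
  ∀ (X : Set V) (a : ι → ℕ), X.Finite → (∀ t n, a t ≤ n → (R t).vert n ∉ X) →
    ∃ (D : K → Set V) (b : ι → ℕ), (∀ t, a t ≤ b t) ∧ (∀ i, (D i).Finite) ∧
      (∀ i, (G.induce (D i)).Connected) ∧ (Pairwise fun i j => Disjoint (D i) (D j)) ∧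
      (∀ i, Disjoint (D i) X) ∧ (∀ i t n, b t < n → (R t).vert n ∉ D i) ∧
      (∀ i, (R (f i)).vert (a (f i)) ∈ D i) ∧ (∀ i, (R (g i)).vert (b (g i)) ∈ D i) ∧
      ∀ i j, A i j → ∃ x ∈ D i, ∃ y ∈ D j, G.Adj x y

variable {R : ι → G.Ray} {A A' : K → K → Prop} {f g h : K → ι}

theorem HasBlocks.mono (hA : HasBlocks R A f g) (hle : ∀ i j, A' i j → A i j) :
    HasBlocks R A' f g := by
  intro X a hX ha
  obtain ⟨D, b, h1, h2, h3, h4, h5, h6, h7, h8, h9⟩ := hA X a hX ha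
  exact ⟨D, b, h1, h2, h3, h4, h5, h6, h7, h8, fun i j hij => h9 i j (hle i j hij)⟩

/-- The second round starts one index after the first round's end on every ray and avoids the first
blocks; the ray edge after index `b (g i)` glues the two blocks of token `i`. -/
theorem HasBlocks.trans [Finite K] (hA : HasBlocks R A f g) (hA' : HasBlocks R A' g h) :
    HasBlocks R (fun i j => A i j ∨ A' i j) f h := by
  intro X a hX ha
  obtain ⟨D, b, h1, h2, h3, h4, h5, h6, h7, h8, h9⟩ := hA X a hX ha
  obtain ⟨D', b', h1', h2', h3', h4', h5', h6', h7', h8', h9'⟩ :=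
    hA' (X ∪ ⋃ i, D i) (fun t => b t + 1) (hX.union (Set.finite_iUnion h2)) (by
      rintro t n hn (hmem | hmem)
      · exact ha t n (by have := h1 t; omega) hmem
      · obtain ⟨i, hi⟩ := Set.mem_iUnion.1 hmem
        exact h6 i t n (by omega) hi)
  have hDD' : ∀ i j, Disjoint (D i) (D' j) := fun i j =>
    (h5' j).symm.mono_left ((Set.subset_iUnion D i).trans Set.subset_union_right)
  refine ⟨fun i => D i ∪ D' i, b', fun t => (h1 t).trans ((Nat.le_succ _).trans (h1' t)),
    fun i => (h2 i).union (h2' i), fun i => ?_, fun i j hij => ?_, fun i => ?_, ?_,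
    fun i => Or.inl (h7 i), fun i => Or.inr (h8' i), ?_⟩
  · exact connected_induce_union (h3 i).preconnected (h3' i).preconnected (h8 i) (h7' i)
      ((R (g i)).adj _)
  · simp only [Set.disjoint_union_left, Set.disjoint_union_right]
    exact ⟨⟨h4 hij, (hDD' j i).symm⟩, hDD' i j, h4' hij⟩
  · exact Set.disjoint_union_left.2 ⟨h5 i, (h5' i).mono_right Set.subset_union_left⟩
  · rintro i t n hn (hmem | hmem)
    · exact h6 i t n (by have := h1' t; omega) hmem
    · exact h6' i t n hn hmem
  · rintro i j (hij | hij)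
    · obtain ⟨x, hx, y, hy, hxy⟩ := h9 i j hij
      exact ⟨x, Or.inl hx, y, Or.inl hy, hxy⟩
    · obtain ⟨x, hx, y, hy, hxy⟩ := h9' i j hij
      exact ⟨x, Or.inr hx, y, Or.inr hy, hxy⟩

theorem Ray.ne_of_disjoint (hdisj : Pairwise fun s t => Disjoint (R s).verts (R t).verts)
    {s t : ι} {m n : ℕ} (hne : s ≠ t ∨ m ≠ n) : (R s).vert m ≠ (R t).vert n := by
  intro heq
  by_cases hst : s = t
  · subst hst
    exact (hne.resolve_left (fun h => h rfl)) ((R s).injective heq)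
  · exact (hdisj hst).le_bot ⟨⟨m, rfl⟩, ⟨n, heq.symm⟩⟩

theorem hasBlocks_refl (hdisj : Pairwise fun s t => Disjoint (R s).verts (R t).verts)
    (hf : f.Injective) : HasBlocks R (fun _ _ => False) f f := by
  intro X a _ ha
  refine ⟨fun i => {(R (f i)).vert (a (f i))}, a, fun _ => le_rfl, fun i => Set.finite_singleton _,
    fun i => connected_induce_singleton _, fun i j hij => ?_, fun i => ?_, ?_, fun i => rfl,
    fun i => rfl, fun i j h => h.elim⟩
  · exact Set.disjoint_singleton.2 (Ray.ne_of_disjoint hdisj (Or.inl (hf.ne hij)))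
  · exact Set.disjoint_singleton_left.2 (ha _ _ le_rfl)
  · intro i t n hn hmem
    refine Ray.ne_of_disjoint hdisj ?_ (Set.mem_singleton_iff.1 hmem)
    by_cases hti : t = f i
    · subst hti
      exact Or.inr hn.ne'
    · exact Or.inl hti

/-- From an index `a s` on the ray `R s` one can reach a neighbour of the ray `R t`, inside a
finite connected set avoiding `X` and all other rays. -/
theorem exists_connected_of_rayGraph_adj [Finite ι]
    (hdisj : Pairwise fun s t => Disjoint (R s).verts (R t).verts) {s t : ι}
    (hst : (rayGraph R).Adj s t) {X : Set V} {a : ι → ℕ} (hX : X.Finite)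
    (ha : ∀ t n, a t ≤ n → (R t).vert n ∉ X) :
    ∃ (W : Set V) (n m : ℕ), a s ≤ n ∧ a t ≤ m ∧ W.Finite ∧ (G.induce W).Connected ∧
      (R s).vert (a s) ∈ W ∧ Disjoint W X ∧
      (∀ u l, (R u).vert l ∈ W → u = s ∧ l ≤ n) ∧
      ∃ w ∈ W, G.Adj w ((R t).vert m) := by
  -- Forbidding the initial segments of all rays as well forces both ends of the connecting walk
  -- beyond the indices `a`.
  obtain ⟨hne, h⟩ := hst
  obtain ⟨x, ⟨n, rfl⟩, y, ⟨m, rfl⟩, p, hp⟩ := h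
    (X ∪ ⋃ u, (R u).vert '' Set.Iio (a u))
    (hX.union (Set.finite_iUnion fun u => (Set.finite_Iio _).image _))
  have hbound : ∀ u l, (R u).vert l ∈ p.support → a u ≤ l := by
    intro u l hl
    by_contra hcon
    exact (hp _ hl).1 (Or.inr (Set.mem_iUnion.2 ⟨u, l, by simpa using hcon, rfl⟩))
  have hn := hbound s n p.start_mem_support
  have hm := hbound t m p.end_mem_support
  obtain ⟨W, hWfin, hW, hxW, hyW, hWp, w, hw, hadj⟩ :=
    p.exists_connected_init (Ray.ne_of_disjoint hdisj (Or.inl hne))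
  obtain ⟨d, rfl⟩ := Nat.exists_eq_add_of_le hn
  refine ⟨(R s).vert '' Set.Icc (a s) (a s + d) ∪ W, a s + d, m, hn, hm,
    ((Set.finite_Icc _ _).image _).union hWfin,
    induce_union_connected ((R s).connected_segment _ _).preconnected hW.preconnected
      ⟨_, ⟨a s + d, by simp, rfl⟩, hxW⟩, Or.inl ⟨a s, by simp, rfl⟩, ?_, ?_, w, Or.inr hw, hadj⟩
  · rw [Set.disjoint_left]
    rintro z (⟨l, hl, rfl⟩ | hz)
    · exact ha _ _ hl.1
    · exact fun hzX => (hp z (hWp z hz)).1 (Or.inl hzX)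
  · rintro u l (⟨l', hl', heq⟩ | hz)
    · by_cases hus : u = s
      · subst hus
        exact ⟨rfl, (R u).injective heq ▸ hl'.2⟩
      · exact absurd heq (Ray.ne_of_disjoint hdisj (Or.inl (Ne.symm hus)))
    · rcases (hp _ (hWp _ hz)).2 u ⟨l, rfl⟩ with heq | heq
      · by_cases hus : u = s
        · subst hus
          exact ⟨rfl, ((R u).injective heq).le⟩
        · exact absurd heq (Ray.ne_of_disjoint hdisj (Or.inl hus))
      · rw [heq] at hz
        exact absurd hz hyW

/-- The moving token follows its ray, crosses the connection and stops on the free ray `R t`; every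
other token keeps a one-vertex block. -/
theorem TokenStep.hasBlocks [Finite ι] [DecidableEq K]
    (hdisj : Pairwise fun s t => Disjoint (R s).verts (R t).verts)
    (hf : f.Injective) (hfg : (rayGraph R).TokenStep f g) :
    HasBlocks R (fun _ _ => False) f g := by
  classical
  obtain ⟨i, t, hadj, ht, rfl⟩ := hfg
  intro X a hX ha
  obtain ⟨W, n, m, hn, hm, hWfin, hW, haW, hWX, hWR, w, hw, hwt⟩ :=
    exists_connected_of_rayGraph_adj hdisj hadj hX ha
  have hit : f i ≠ t := hadj.ne
  have hft : ∀ j, f j ≠ t := fun j hj => ht ⟨j, hj⟩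
  refine ⟨fun j => if j = i then insert ((R t).vert m) W else {(R (f j)).vert (a (f j))},
    fun u => if u = f i then n else if u = t then m else a u, fun u => ?_, fun j => ?_, fun j => ?_,
    fun j l hjl => ?_, fun j => ?_, ?_, fun j => ?_, fun j => ?_, fun _ _ h => h.elim⟩
  · dsimp only
    split_ifs with h1 h2
    · rwa [h1]
    · rwa [h2]
    · exact le_rfl
  · dsimp only
    split_ifs
    · exact hWfin.insert _
    · exact Set.finite_singleton _
  · by_cases h1 : j = i
    · dsimp only
      rw [if_pos h1]
      exact connected_induce_insert hW hw hwt.symm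
    · dsimp only
      rw [if_neg h1]
      exact connected_induce_singleton _
  · have hmain : ∀ j, j ≠ i → (R (f j)).vert (a (f j)) ∉ insert ((R t).vert m) W := by
      rintro j hj (hmem | hmem)
      · exact Ray.ne_of_disjoint hdisj (Or.inl (hft j)) hmem
      · exact hj (hf (hWR _ _ hmem).1)
    dsimp only
    split_ifs with h1 h2 h2
    · exact absurd (h1.trans h2.symm) hjl
    · exact Set.disjoint_singleton_right.2 (hmain l h2)
    · exact Set.disjoint_singleton_left.2 (hmain j h1)
    · exact Set.disjoint_singleton.2 (Ray.ne_of_disjoint hdisj (Or.inl (hf.ne hjl)))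
  · dsimp only
    split_ifs
    · rw [Set.insert_eq, Set.disjoint_union_left, Set.disjoint_singleton_left]
      exact ⟨ha _ _ hm, hWX⟩
    · exact Set.disjoint_singleton_left.2 (ha _ _ le_rfl)
  · intro j u l hl hmem
    dsimp only at hl hmem
    by_cases hji : j = i
    · rw [if_pos hji] at hmem
      rcases hmem with hmem | hmem
      · by_cases hut : u = t
        · subst hut
          rw [if_neg hit.symm, if_pos rfl, (R u).injective hmem] at hl
          omega
        · exact Ray.ne_of_disjoint hdisj (Or.inl hut) hmem
      · obtain ⟨rfl, hln⟩ := hWR _ _ hmem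
        rw [if_pos rfl] at hl
        omega
    · rw [if_neg hji] at hmem
      by_cases hu : u = f j
      · subst hu
        rw [if_neg (hf.ne hji), if_neg (hft j),
          (R (f j)).injective (Set.mem_singleton_iff.1 hmem)] at hl
        omega
      · exact Ray.ne_of_disjoint hdisj (Or.inl hu) (Set.mem_singleton_iff.1 hmem)
  · dsimp only
    split_ifs with h1
    · rw [h1]
      exact Set.mem_insert_of_mem _ haW
    · rfl
  · by_cases h1 : j = i
    · subst h1
      simp [hit.symm]
    · simp [h1, hf.eq_iff, hft]

theorem TokenReach.hasBlocks [Finite ι] [Finite K] [DecidableEq K]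
    (hdisj : Pairwise fun s t => Disjoint (R s).verts (R t).verts)
    (hf : f.Injective) (hfg : (rayGraph R).TokenReach f g) :
    HasBlocks R (fun _ _ => False) f g := by
  induction hfg with
  | refl => exact hasBlocks_refl hdisj hf
  | tail h' h ih =>
    exact (ih.trans (h.hasBlocks hdisj (TokenReach.injective h' hf))).mono fun _ _ h => h.elim

/-- Block `i` follows its ray and absorbs the connection except for its last vertex, which lies on
`R (f j)`; block `j` is prolonged to that vertex, and this produces the edge. -/
theorem hasBlocks_of_adj [Finite ι] [DecidableEq K]
    (hdisj : Pairwise fun s t => Disjoint (R s).verts (R t).verts)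
    (hf : f.Injective) {i j : K} (hadj : (rayGraph R).Adj (f i) (f j)) :
    HasBlocks R (fun i' j' => i' = i ∧ j' = j) f f := by
  classical
  intro X a hX ha
  obtain ⟨W, n, m, hn, hm, hWfin, hW, haW, hWX, hWR, w, hw, hwt⟩ :=
    exists_connected_of_rayGraph_adj hdisj hadj hX ha
  have hij : i ≠ j := fun h => hadj.ne (congrArg f h)
  set b : ι → ℕ := fun u => if u = f i then n else if u = f j then m else a u with hb
  have hab : ∀ u, a u ≤ b u := by
    intro u
    simp only [hb]
    split_ifs with h1 h2
    · rwa [h1]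
    · rwa [h2]
    · exact le_rfl
  have hbi : b (f i) = n := by simp [hb]
  have hbj : b (f j) = m := by simp [hb, hf.eq_iff, hij.symm]
  obtain ⟨d, hd⟩ : ∃ d : ι → ℕ, ∀ u, b u = a u + d u :=
    ⟨fun u => b u - a u, fun u => by have := hab u; dsimp only; omega⟩
  set E : K → Set V := fun l => (R (f l)).vert '' Set.Icc (a (f l)) (a (f l) + d (f l)) with hE
  set D : K → Set V := fun l => if l = i then W ∪ E i else E l with hD
  have hWE : (R (f i)).vert (a (f i)) ∈ W ∩ E i := ⟨haW, a (f i), by simp, rfl⟩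
  have hDR : ∀ l u q, (R u).vert q ∈ D l → u = f l ∧ q ≤ b u := by
    intro l u q hmem
    have hEl : ∀ l, (R u).vert q ∈ E l → u = f l ∧ q ≤ b u := by
      rintro l ⟨q', hq', heq⟩
      by_cases hu : u = f l
      · subst hu
        rw [hd]
        exact ⟨rfl, (R _).injective heq ▸ hq'.2⟩
      · exact absurd heq.symm (Ray.ne_of_disjoint hdisj (Or.inl hu))
    simp only [hD] at hmem
    split_ifs at hmem with hli
    · subst hli
      rcases hmem with hmem | hmem
      · obtain ⟨rfl, hq⟩ := hWR u q hmem
        exact ⟨rfl, by rwa [hbi]⟩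
      · exact hEl l hmem
    · exact hEl l hmem
  have hED : ∀ l, E l ⊆ D l := by
    intro l x hx
    simp only [hD]
    split_ifs with hli
    · subst hli
      exact Or.inr hx
    · exact hx
  have hEfin : ∀ l, (E l).Finite := fun l => (Set.finite_Icc _ _).image _
  have hEX : ∀ l, Disjoint (E l) X := by
    intro l
    rw [Set.disjoint_left]
    rintro z ⟨q, hq, rfl⟩
    exact ha _ _ hq.1
  refine ⟨D, b, hab, fun l => ?_, fun l => ?_, fun l l' hll' => ?_, fun l => ?_,
    fun l u q hq hmem => ?_, fun l => hED l ⟨_, by simp, rfl⟩, fun l => hED l ⟨_, ?_, rfl⟩, ?_⟩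
  · simp only [hD]
    split_ifs
    · exact hWfin.union (hEfin i)
    · exact hEfin l
  · by_cases hli : l = i
    · rw [hD]
      dsimp only
      rw [if_pos hli]
      exact induce_union_connected hW.preconnected
        ((R (f i)).connected_segment _ _).preconnected ⟨_, hWE⟩
    · rw [hD]
      dsimp only
      rw [if_neg hli]
      exact (R (f l)).connected_segment _ _
  · have hmain : ∀ l l', l ≠ l' → l' ≠ i → Disjoint (D l) (D l') := by
      intro l l' hne hl'
      rw [Set.disjoint_right]
      intro z hz hz'
      have hz2 := hz
      simp only [hD, if_neg hl'] at hz2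
      obtain ⟨q, -, rfl⟩ := hz2
      exact hne (hf ((hDR l _ _ hz').1.symm))
    by_cases hl' : l' = i
    · exact (hmain l' l hll'.symm fun h => hll' (h.trans hl'.symm)).symm
    · exact hmain l l' hll' hl'
  · simp only [hD]
    split_ifs
    · exact Set.disjoint_union_left.2 ⟨hWX, hEX i⟩
    · exact hEX l
  · have := (hDR l u q hmem).2
    omega
  · rw [hd]
    simp
  · rintro i' j' ⟨rfl, rfl⟩
    refine ⟨w, ?_, (R (f j')).vert m, hED j' ⟨m, ?_, rfl⟩, hwt⟩
    · simp [hD, hw]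
    · rw [← hd, hbj]
      exact ⟨hm, le_rfl⟩

/-- If the token pairs in `A` can be brought together, then there are blocks joining them. -/
theorem hasBlocks_of_tokenReach [Finite ι] [Finite K] [DecidableEq K]
    (hdisj : Pairwise fun s t => Disjoint (R s).verts (R t).verts) (hf : f.Injective)
    (hA : ∀ i j, A i j → ∃ g, (rayGraph R).TokenReach f g ∧ (rayGraph R).Adj (g i) (g j)) :
    HasBlocks R A f f := by
  classical
  -- Move to `g`, add the edge, then reverse the moves; returning to `f` allows these excursions to
  -- be chained over all pairs.
  have hone : ∀ i j, A i j → HasBlocks R (fun i' j' => i' = i ∧ j' = j) f f := by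
    intro i j hij
    obtain ⟨g, hg, hadj⟩ := hA i j hij
    have hgi := hg.injective hf
    refine (((hg.hasBlocks hdisj hf).trans (hasBlocks_of_adj hdisj hgi hadj)).trans
      ((hg.symm hf).hasBlocks hdisj hgi)).mono fun i' j' h => Or.inl (Or.inr h)
  have hset : ∀ P : Set (K × K), P.Finite → P ⊆ {q | A q.1 q.2} →
      HasBlocks R (fun i j => (i, j) ∈ P) f f := by
    intro P hP
    induction P, hP using Set.Finite.induction_on with
    | empty => exact fun _ => hasBlocks_refl hdisj hf
    | @insert q P _ _ ih =>
      intro hsub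
      refine ((hone q.1 q.2 (hsub (Set.mem_insert _ _))).trans
        (ih ((Set.subset_insert _ _).trans hsub))).mono fun i j hij => ?_
      rcases hij with rfl | hij
      · exact Or.inl ⟨rfl, rfl⟩
      · exact Or.inr hij
  exact hset {q | A q.1 q.2} (Set.toFinite _) subset_rfl

end Block

/-! ### Infinite sequences of layers, and rays through them -/

section Limit

variable {V : Type*} {G : SimpleGraph V}

theorem Connected.exists_isPath_of_induce {s : Set V} (hs : (G.induce s).Connected) {x y : V}
    (hx : x ∈ s) (hy : y ∈ s) : ∃ p : G.Walk x y, p.IsPath ∧ ∀ z ∈ p.support, z ∈ s := by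
  obtain ⟨p, hp⟩ := hs.exists_isPath ⟨x, hx⟩ ⟨y, hy⟩
  let φ : G.induce s →g G := (Embedding.induce s).toHom
  have hφ : Function.Injective φ := (Embedding.induce (G := G) s).injective
  refine ⟨p.map φ, hp.map hφ, fun z hz => ?_⟩
  have hz' : z ∈ @Walk.support _ _ (φ ⟨x, hx⟩) (φ ⟨y, hy⟩) (p.map φ) := hz
  rw [Walk.support_map] at hz'
  obtain ⟨z', -, rfl⟩ := List.mem_map.1 hz'
  exact z'.2

/-- Two rays are equivalent if they both meet infinitely many disjoint connected sets. -/
theorem Ray.equivalent_of_connected {κ : Type*} {C : κ → Set V}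
    (hdisj : Pairwise fun m n => Disjoint (C m) (C n)) {I : Set κ} (hI : I.Infinite) {P Q : G.Ray}
    (hC : ∀ n ∈ I, (G.induce (C n)).Connected ∧ (∃ x ∈ P.verts, x ∈ C n) ∧
      ∃ y ∈ Q.verts, y ∈ C n) : P.Equivalent Q := by
  intro S hS hsep
  -- By disjointness each vertex of `S` lies in at most one `C n`, so some `C n` with `n ∈ I` avoids
  -- `S`.
  have hfin : {n | ∃ s ∈ S, s ∈ C n}.Finite := by
    have : {n | ∃ s ∈ S, s ∈ C n} = ⋃ s ∈ S, {n | s ∈ C n} := by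
      ext n
      simp
    rw [this]
    refine hS.biUnion fun s _ => Set.Subsingleton.finite fun m hm n hn => ?_
    by_contra hmn
    exact (hdisj hmn).le_bot ⟨hm, hn⟩
  obtain ⟨n, hn, hnS⟩ := hI.exists_notMem_finite hfin
  obtain ⟨hconn, ⟨x, hxP, hx⟩, y, hyQ, hy⟩ := hC n hn
  obtain ⟨p, -, hp⟩ := hconn.exists_isPath_of_induce hx hy
  obtain ⟨z, hz, hzS⟩ := hsep x hxP y hyQ p
  exact hnS ⟨z, hzS, hp z hz⟩

/-- Disjoint finite paths which are joined one after the other form a ray. -/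
theorem exists_ray_of_paths {C : ℕ → Set V} (hdisj : Pairwise fun m n => Disjoint (C m) (C n))
    {s e : ℕ → V} {p : ∀ n, G.Walk (s n) (e n)} (hp : ∀ n, (p n).IsPath)
    (hpC : ∀ n, ∀ z ∈ (p n).support, z ∈ C n) (hadj : ∀ n, G.Adj (e n) (s (n + 1))) :
    ∃ (R : G.Ray) (φ : ℕ → ℕ), Monotone φ ∧ Function.Surjective φ ∧
      ∀ n, R.vert n ∈ C (φ n) := by
  -- A state records the current path and the position on it; states increase strictly in the
  -- lexicographic order, so none recurs.
  let next : ℕ × ℕ → ℕ × ℕ := fun q =>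
    if q.2 < (p q.1).length then (q.1, q.2 + 1) else (q.1 + 1, 0)
  let st : ℕ → ℕ × ℕ := fun N => next^[N] (0, 0)
  have hst : ∀ N, st (N + 1) = next (st N) := fun N => Function.iterate_succ_apply' _ _ _
  have hle : ∀ N, (st N).2 ≤ (p (st N).1).length := by
    intro N
    induction N with
    | zero => exact Nat.zero_le _
    | succ N ih =>
      rw [hst]
      by_cases h : (st N).2 < (p (st N).1).length
      · rw [show next (st N) = ((st N).1, (st N).2 + 1) from if_pos h]
        exact h
      · rw [show next (st N) = ((st N).1 + 1, 0) from if_neg h]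
        exact Nat.zero_le _
  have hstep : ∀ N, (st N).1 < (st (N + 1)).1 ∨
      (st N).1 = (st (N + 1)).1 ∧ (st N).2 < (st (N + 1)).2 := by
    intro N
    rw [hst]
    simp only [next]
    split_ifs with h
    · exact Or.inr ⟨rfl, Nat.lt_succ_self _⟩
    · exact Or.inl (Nat.lt_succ_self _)
  have hmono : StrictMono fun N => toLex (st N) := by
    refine strictMono_nat_of_lt_succ fun N => ?_
    rw [Prod.Lex.toLex_lt_toLex]
    exact hstep N
  have hstinj : Function.Injective st := fun a b hab =>
    hmono.injective (congrArg toLex hab)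
  have hC : ∀ N, (p (st N).1).getVert (st N).2 ∈ C (st N).1 := fun N =>
    hpC _ _ (Walk.getVert_mem_support _ _)
  refine ⟨⟨fun N => (p (st N).1).getVert (st N).2, fun a b hab => ?_, fun N => ?_⟩,
    fun N => (st N).1, ?_, ?_, hC⟩
  · dsimp only at hab
    have h1 : (st a).1 = (st b).1 := by
      by_contra hne
      refine (hdisj hne).le_bot ⟨hC a, ?_⟩
      rw [hab]
      exact hC b
    have h2 := hle a
    rw [h1] at hab h2
    exact hstinj (Prod.ext h1 ((hp _).getVert_injOn h2 (hle b) hab))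
  · rw [hst]
    by_cases h : (st N).2 < (p (st N).1).length
    · rw [show next (st N) = ((st N).1, (st N).2 + 1) from if_pos h]
      exact (p (st N).1).adj_getVert_succ h
    · rw [show next (st N) = ((st N).1 + 1, 0) from if_neg h]
      have h2 : (st N).2 = (p (st N).1).length := le_antisymm (hle N) (not_lt.1 h)
      rw [h2, Walk.getVert_length]
      simpa using hadj (st N).1
  · refine monotone_nat_of_le_succ fun N => ?_
    rcases hstep N with h | h
    · exact h.le
    · exact h.1.le
  · have hreach : ∀ n, ∃ N, st N = (n, 0) := by
      intro n
      induction n with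
      | zero => exact ⟨0, rfl⟩
      | succ n ih =>
        obtain ⟨N, hN⟩ := ih
        have hrun : ∀ j ≤ (p n).length, st (N + j) = (n, j) := by
          intro j
          induction j with
          | zero => exact fun _ => hN
          | succ j ihj =>
            intro hj
            rw [← Nat.add_assoc, hst, ihj (by omega)]
            simp only [next]
            rw [if_pos (by omega)]
        refine ⟨N + (p n).length + 1, ?_⟩
        rw [hst, hrun _ le_rfl]
        simp [next]
    intro n
    obtain ⟨N, hN⟩ := hreach n
    exact ⟨N, by simp [hN]⟩

variable {ι K : Type*} {R : ι → G.Ray} {A : K → K → Prop} {f g : K → ι}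

theorem HasBlocks.comp {L : Type*} (h : HasBlocks R A f g) {e : L → K} (he : e.Injective) :
    HasBlocks R (fun i j => A (e i) (e j)) (f ∘ e) (g ∘ e) := by
  intro X a hX ha
  obtain ⟨D, b, h1, h2, h3, h4, h5, h6, h7, h8, h9⟩ := h X a hX ha
  exact ⟨D ∘ e, b, h1, fun i => h2 _, fun i => h3 _, fun i j hij => h4 (he.ne hij), fun i => h5 _,
    fun i => h6 _, fun i => h7 _, fun i => h8 _, fun i j => h9 _ _⟩

theorem HasBlocks.exists_seq [Finite K] (h : HasBlocks R A f f) :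
    ∃ (D : K × ℕ → Set V) (s e : K → ℕ → V), (∀ q, (D q).Finite) ∧
      (∀ q, (G.induce (D q)).Connected) ∧ (Pairwise fun q q' => Disjoint (D q) (D q')) ∧
      (∀ i n, s i n ∈ D (i, n) ∧ s i n ∈ (R (f i)).verts) ∧ (∀ i n, e i n ∈ D (i, n)) ∧
      (∀ i n, G.Adj (e i n) (s i (n + 1))) ∧
      ∀ i j n, A i j → ∃ x ∈ D (i, n), ∃ y ∈ D (j, n), G.Adj x y := by
  -- A stage consists of the vertices used so far and, for every ray, an index from which it avoids
  -- them.
  let Stage := {σ : Set V × (ι → ℕ) // σ.1.Finite ∧ ∀ t n, σ.2 t ≤ n → (R t).vert n ∉ σ.1}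
  have hB : ∀ σ : Stage, _ := fun σ => h σ.1.1 σ.1.2 σ.2.1 σ.2.2
  choose D b h1 h2 h3 h4 h5 h6 h7 h8 h9 using hB
  let next : Stage → Stage := fun σ => ⟨(σ.1.1 ∪ ⋃ i, D σ i, fun t => b σ t + 1),
    σ.2.1.union (Set.finite_iUnion (h2 σ)), by
      rintro t n hn (hmem | hmem)
      · exact σ.2.2 t n ((h1 σ t).trans ((Nat.le_succ _).trans hn)) hmem
      · obtain ⟨i, hi⟩ := Set.mem_iUnion.1 hmem
        exact h6 σ i t n hn hi⟩
  let σ : ℕ → Stage := fun n => next^[n] ⟨(∅, 0), Set.finite_empty, fun _ _ _ h => h⟩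
  have hσ : ∀ n, σ (n + 1) = next (σ n) := fun n => Function.iterate_succ_apply' _ _ _
  have hsub : ∀ m d i, D (σ m) i ⊆ (σ (m + d + 1)).1.1 := by
    intro m d i
    induction d with
    | zero =>
      rw [hσ]
      exact (Set.subset_iUnion (D (σ m)) i).trans Set.subset_union_right
    | succ d ih =>
      rw [← Nat.add_assoc, hσ]
      exact ih.trans Set.subset_union_left
  have hlt : ∀ m n i j, m < n → Disjoint (D (σ m) i) (D (σ n) j) := by
    intro m n i j hmn
    obtain ⟨d, rfl⟩ := Nat.exists_eq_add_of_lt hmn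
    exact ((h5 _ j).mono_right (hsub m d i)).symm
  refine ⟨fun q => D (σ q.2) q.1, fun i n => (R (f i)).vert ((σ n).1.2 (f i)),
    fun i n => (R (f i)).vert (b (σ n) (f i)), fun q => h2 _ _, fun q => h3 _ _, ?_,
    fun i n => ⟨h7 _ _, _, rfl⟩, fun i n => h8 _ _, fun i n => ?_, fun i j n => h9 _ i j⟩
  · rintro ⟨i, m⟩ ⟨j, n⟩ hne
    rcases lt_trichotomy m n with hmn | rfl | hmn
    · exact hlt m n i j hmn
    · exact h4 _ fun hij => hne (Prod.ext hij rfl)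
    · exact (hlt n m j i hmn).symm
  · dsimp only
    rw [hσ]
    exact (R (f i)).adj _

end Limit

/-! ### From vertex-degree to disjoint rays -/

section Degree

variable {V : Type*} {G : SimpleGraph V}

theorem RayEnd.exists_disjoint_rays {ω : G.RayEnd} {d : ℕ} (hd : (d : ℕ∞) ≤ ω.vertexDegree) :
    ∃ R : Fin d → G.Ray, (∀ i, (R i).toEnd = ω) ∧
      Pairwise fun i j => Disjoint (R i).verts (R j).verts := by
  rcases Nat.eq_zero_or_pos d with rfl | hpos
  · exact ⟨Fin.elim0, fun i => i.elim0, fun i => i.elim0⟩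
  obtain ⟨d, rfl⟩ := Nat.exists_eq_add_of_le' hpos
  -- The strict bound by one less yields a family exceeding it, without knowing that the supremum is
  -- attained.
  have hlt : (d : ℕ∞) < ω.vertexDegree := lt_of_lt_of_le (by exact_mod_cast Nat.lt_succ_self d) hd
  simp only [RayEnd.vertexDegree, lt_iSup_iff] at hlt
  obtain ⟨𝓡, hω, hdisj, hcard⟩ := hlt
  have hcard' : ((d + 1 : ℕ) : ℕ∞) ≤ 𝓡.encard := by
    push_cast
    exact Order.add_one_le_of_lt hcard
  obtain ⟨T, hT, hTcard⟩ := Set.exists_subset_encard_eq hcard'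
  have hTfin : T.Finite := Set.finite_of_encard_eq_coe hTcard
  have := hTfin.fintype
  have hc : Fintype.card T = d + 1 := by
    rw [← Set.toFinset_card, ← Set.ncard_eq_toFinset_card', Set.ncard, hTcard]
    rfl
  let e : Fin (d + 1) ≃ T := (Fintype.equivFinOfCardEq hc).symm
  exact ⟨fun i => (e i).1, fun i => hω _ (hT (e i).2), fun i j hij =>
    hdisj (hT (e i).2) (hT (e j).2) fun h => hij (e.injective (Subtype.ext h))⟩

theorem le_vertexDegree_of_real_le {δ : ℕ∞} {k d : ℕ} (hd : 2 * d < 3 * k)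
    (h : (((3 / 2 : ℝ) * (k : ℝ) - 1 : ℝ) : EReal) ≤ ((δ : ENNReal) : EReal)) :
    (d : ℕ∞) ≤ δ := by
  by_contra hcon
  rw [not_le] at hcon
  obtain ⟨n, rfl⟩ := ENat.ne_top_iff_exists.1 hcon.ne_top
  have hn : n < d := by exact_mod_cast hcon
  have h' : (3 / 2 : ℝ) * (k : ℝ) - 1 ≤ (n : ℝ) := by
    have h2 : ((((n : ℕ∞) : ENNReal)) : EReal) = ((n : ℝ) : EReal) := by
      rw [ENat.toENNReal_coe]
      rfl
    rw [h2] at h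
    exact_mod_cast h
  have h3 : (3 * k : ℝ) ≤ 2 * n + 2 := by linarith
  have h4 : 3 * k ≤ 2 * n + 2 := by exact_mod_cast h3
  omega

end Degree

end SimpleGraph

/-! ### The grid theorem -/

open SimpleGraph in
theorem mainTheorem3 {V : Type*} (G : SimpleGraph V) (k : ℕ) (ω : G.RayEnd)
    (hω : (((3 / 2 : ℝ) * (k : ℝ) - 1 : ℝ) : EReal) ≤ ((ω.vertexDegree : ENNReal) : EReal)) :
    ∃ M : SimpleGraph.MinorModel (SimpleGraph.halfGrid k) G,
      (∀ p : Fin k × ℕ, (M.branch p).Finite) ∧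
      (∀ i : Fin k, ∃ R : G.Ray, R.toEnd = ω ∧
        ∃ φ : ℕ → ℕ, Monotone φ ∧ Function.Surjective φ ∧
          ∀ n : ℕ, R.vert n ∈ M.branch (i, φ n)) ∧
      (∀ R : G.Ray, R.verts ⊆ (⋃ p : Fin k × ℕ, M.branch p) → R.toEnd = ω) := by
  rcases Nat.eq_zero_or_pos k with rfl | hk
  · refine ⟨⟨fun _ => ∅, fun q => q.1.elim0, fun q => q.1.elim0, fun q => q.1.elim0⟩,
      fun q => q.1.elim0, fun i => i.elim0, fun R hR => ?_⟩
    obtain ⟨q, -⟩ := Set.mem_iUnion.1 (hR ⟨0, rfl⟩)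
    exact q.1.elim0
  -- `(3 * k - 1) / 2` is `3k/2 - 1` rounded up; two thirds of it exceed `k - 1`, so at least `k`
  -- tokens fit.
  obtain ⟨R, hRω, hdisj⟩ := RayEnd.exists_disjoint_rays
    (le_vertexDegree_of_real_le (d := (3 * k - 1) / 2) (by omega) hω)
  have : Nonempty (Fin ((3 * k - 1) / 2)) := ⟨⟨0, by omega⟩⟩
  have hconn := rayGraph_connected hdisj fun s t => Quotient.exact ((hRω s).trans (hRω t).symm)
  obtain ⟨k', f, hcard, hf, hlink⟩ := hconn.exists_linked_tokens
  rw [Fintype.card_fin] at hcard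
  have hkk' : k ≤ k' := by omega
  obtain ⟨D, s, e, hfin, hD, hDdisj, hs, he, hes, hA⟩ :=
    ((hasBlocks_of_tokenReach hdisj hf hlink).comp (Fin.castLE_injective hkk')).exists_seq
  have hcol : ∀ i : Fin k, Pairwise fun m n => Disjoint (D (i, m)) (D (i, n)) :=
    fun i m n hmn => hDdisj fun h => hmn (Prod.ext_iff.1 h).2
  -- A column may use many rays, but each of its blocks meets the home ray `R (f i)` of its token.
  -- Thus a ray meeting infinitely many blocks of one column is equivalent to that home ray.
  have hend : ∀ (i : Fin k) (Q : G.Ray) (I : Set ℕ), I.Infinite →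
      (∀ n ∈ I, ∃ x ∈ Q.verts, x ∈ D (i, n)) → Q.toEnd = ω := by
    intro i Q I hI hQ
    rw [← hRω (f (Fin.castLE hkk' i))]
    exact Quotient.sound (Ray.equivalent_of_connected (hcol i) hI fun n hn =>
      ⟨hD _, hQ n hn, s i n, (hs i n).2, (hs i n).1⟩)
  refine ⟨⟨D, hD, hDdisj, fun q q' hqq' => ?_⟩, hfin, fun i => ?_, fun Q hQ => ?_⟩
  · obtain ⟨i, m⟩ := q
    obtain ⟨j, n⟩ := q'
    rcases halfGrid_adj.1 hqq' with ⟨hij | hij, hmn⟩ | ⟨hmn | hmn, hij⟩ <;>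
      dsimp only at hij hmn <;> subst hmn
    · exact hA i j m hij
    · obtain ⟨x, hx, y, hy, hxy⟩ := hA j i m hij
      exact ⟨y, hy, x, hx, hxy.symm⟩
    · subst hij
      exact ⟨_, he i m, _, (hs i (m + 1)).1, hes i m⟩
    · subst hij
      exact ⟨_, (hs i (n + 1)).1, _, he i n, (hes i n).symm⟩
  · choose p hp hpD using fun n => (hD (i, n)).exists_isPath_of_induce (hs i n).1 (he i n)
    obtain ⟨Q, φ, hφ, hφs, hQ⟩ := exists_ray_of_paths (hcol i) hp hpD (hes i)
    refine ⟨Q, hend i Q Set.univ Set.infinite_univ fun n _ => ?_, φ, hφ, hφs, hQ⟩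
    obtain ⟨N, rfl⟩ := hφs n
    exact ⟨_, ⟨N, rfl⟩, hQ N⟩
  -- Blocks are finite, so `Q` meets infinitely many of them, and hence infinitely many in one of
  -- the `k` columns.
  · have hI : {q : Fin k × ℕ | ∃ x ∈ Q.verts, x ∈ D q}.Infinite := by
      intro hIfin
      refine Set.infinite_range_of_injective Q.injective
        ((hIfin.biUnion fun q _ => hfin q).subset fun x hx => ?_)
      obtain ⟨q, hq⟩ := Set.mem_iUnion.1 (hQ hx)
      exact Set.mem_biUnion (show q ∈ {q : Fin k × ℕ | ∃ x ∈ Q.verts, x ∈ D q} from ⟨x, hx, hq⟩) hq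
    obtain ⟨i, hi⟩ : ∃ i : Fin k, {n | ∃ x ∈ Q.verts, x ∈ D (i, n)}.Infinite := by
      by_contra hcon
      push Not at hcon
      refine hI ((Set.finite_iUnion fun i => (hcon i).image (Prod.mk i)).subset ?_)
      rintro ⟨i, n⟩ hq
      exact Set.mem_iUnion.2 ⟨i, n, hq, rfl⟩
    exact hend i Q _ hi fun n hn => hn
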